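/- Let $\lambda>0$ be a real number. Its spectral radius order $\kappa(\lambda)$ is the least number of vertices of a finite simple graph whose spectral radius (the largest eigenvalue of its adjacency matrix) equals $\lambda$, with $\kappa(\lambda)=\infty$ if there is no such graph. The algebraic conjugates of an algebraic number are the complex roots of its minimal polynomial over $\mathbb{Q}$; an algebraic integer is totally real if all of its algebraic conjugates are real. Suppose that $\lambda$ is algebraic of degree $2$ over $\mathbb{Q}$, or that $\lambda\le 2$. Then $\kappa(\lambda)<\infty$ if and only if $\lambda$ is a totally real algebraic integer and $\lambda\ge|\lambda'|$ for every algebraic conjugate $\lambda'$ of $\lambda$. Moreover, if $\lambda\le 2$ and $\kappa(\lambda)<\infty$, then either $\lambda=2\cos(\pi/n)$ for some integer $n\ge 3$, and $\lambda$ is the spectral radius of the path on $n-1$ vertices, or $\lambda=2$, and $\lambda$ is the spectral radius of $K_3$. -/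

import Mathlib

open Classical in
/-- `lam` is the spectral radius of the finite simple graph `G`, that is, the largest (real)
eigenvalue of the adjacency matrix of `G`. -/
def IsGraphSpectralRadius {V : Type*} [Fintype V] (G : SimpleGraph V) (lam : ℝ) : Prop :=
  IsGreatest (spectrum ℝ (G.adjMatrix ℝ)) lam

/-- The spectral radius order `κ(lam)`: the least number of vertices of a finite simple graph with
spectral radius `lam`, and `⊤` (infinity) if there is no such graph. -/
noncomputable def spectralRadiusOrder (lam : ℝ) : ℕ∞ :=
  ⨅ (m : ℕ) (_ : ∃ G : SimpleGraph (Fin m), IsGraphSpectralRadius G lam), (m : ℕ∞)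

/-- `z` is an algebraic conjugate of the real number `lam`: a complex root of the minimal
polynomial of `lam` over `ℚ`. Meaningful for algebraic `lam`. -/
def IsAlgConjugate (lam : ℝ) (z : ℂ) : Prop :=
  Polynomial.aeval z (minpoly ℚ lam) = 0

/-- `lam` is a totally real algebraic integer: all of its algebraic conjugates are real. -/
def IsTotallyRealInteger (lam : ℝ) : Prop :=
  IsIntegral ℤ lam ∧ ∀ z : ℂ, IsAlgConjugate lam z → z.im = 0

/-! Necessity: conjugates of a graph eigenvalue are roots of the characteristic polynomial of a
symmetric integer matrix, hence real eigenvalues, and `IsGraphSpectralRadius.abs_le` bounds them by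
the spectral radius. Sufficiency exhibits graphs with positive eigenvectors, which certify the
spectral radius. In degree 2, the trace is split into nearly equal naturals `p` and `s`, which makes
`lam` the Perron root of a 2×2 quotient matrix of `biregularGraph`. For `lam ≤ 2`, Kronecker's
theorem makes `lam` twice the cosine of a rational angle, and dominance over the conjugates leaves
only `2` and `2 cos (π / n)`, realised by the triangle and the paths. -/

/-! ### Positive eigenvectors and finiteness of the order. -/

open Classical in
/-- A positive eigenvector of the adjacency matrix certifies the spectral radius. -/
theorem isGraphSpectralRadius_of_pos_eigenvector {V : Type*} [Fintype V] [Nonempty V]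
    (G : SimpleGraph V) {lam : ℝ} (x : V → ℝ) (hx : ∀ v, 0 < x v)
    (h : ∀ v, ∑ w, (if G.Adj v w then x w else 0) = lam * x v) :
    IsGraphSpectralRadius G lam := by
  have mulVec_eq (y : V → ℝ) (v : V) :
      ((G.adjMatrix ℝ).mulVec y) v = ∑ w, (if G.Adj v w then y w else 0) := by
    simp [Matrix.mulVec, dotProduct, SimpleGraph.adjMatrix_apply]
  constructor
  · rw [← Matrix.spectrum_toLin', ← Module.End.hasEigenvalue_iff_mem_spectrum]
    refine Module.End.hasEigenvalue_of_hasEigenvector (x := x)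
      ⟨Module.End.mem_eigenspace_iff.2 ?_, fun h0 => ?_⟩
    · ext v
      rw [Matrix.toLin'_apply, mulVec_eq, h]
      simp
    · obtain ⟨v⟩ := ‹Nonempty V›
      exact (hx v).ne' (congrFun h0 v)
  · intro μ hμ
    rw [← Matrix.spectrum_toLin', ← Module.End.hasEigenvalue_iff_mem_spectrum] at hμ
    obtain ⟨y, hy, hy0⟩ := hμ.exists_hasEigenvector
    rw [Module.End.mem_eigenspace_iff] at hy
    -- At a vertex maximising `|y v| / x v`, the eigenvalue equation for `y` is dominated termwise
    -- by the one for `x`.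
    obtain ⟨v, -, hv⟩ := Finset.exists_max_image Finset.univ (fun v => |y v| / x v)
      Finset.univ_nonempty
    set t := |y v| / x v with ht
    have hyt (w : V) : |y w| ≤ t * x w := (div_le_iff₀ (hx w)).1 (hv w (Finset.mem_univ w))
    have hvt : |y v| = t * x v := by rw [ht, div_mul_cancel₀ _ (hx v).ne']
    have hpos : 0 < |y v| := by
      obtain ⟨w, hw⟩ := Function.ne_iff.1 hy0
      have h1 : 0 < |y w| := abs_pos.2 hw
      have h2 : 0 < t := pos_of_mul_pos_left (h1.trans_le (hyt w)) (hx w).le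
      rw [hvt]
      exact mul_pos h2 (hx v)
    have key : μ * |y v| ≤ lam * |y v| :=
      calc μ * |y v| ≤ |μ * y v| := by
            rw [abs_mul]; exact mul_le_mul_of_nonneg_right (le_abs_self _) hpos.le
        _ = |∑ w, (if G.Adj v w then y w else 0)| := by
            rw [← mulVec_eq, ← Matrix.toLin'_apply, hy]; simp
        _ ≤ ∑ w, |if G.Adj v w then y w else 0| := Finset.abs_sum_le_sum_abs _ _
        _ ≤ ∑ w, t * (if G.Adj v w then x w else 0) := by
            refine Finset.sum_le_sum fun w _ => ?_
            split_ifs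
            · exact hyt w
            · simp
        _ = lam * |y v| := by rw [← Finset.mul_sum, h, hvt]; ring
    exact le_of_mul_le_mul_right key hpos

theorem spectralRadiusOrder_lt_top_iff {lam : ℝ} :
    spectralRadiusOrder lam < ⊤ ↔
      ∃ (m : ℕ) (G : SimpleGraph (Fin m)), IsGraphSpectralRadius G lam := by
  simp [spectralRadiusOrder, iInf_lt_iff]

open Classical in
theorem spectralRadiusOrder_lt_top_of_pos_eigenvector {V : Type*} [Fintype V] [Nonempty V]
    (G : SimpleGraph V) {lam : ℝ} (x : V → ℝ) (hx : ∀ v, 0 < x v)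
    (h : ∀ v, ∑ w, (if G.Adj v w then x w else 0) = lam * x v) :
    spectralRadiusOrder lam < ⊤ := by
  let e := (Fintype.equivFin V).symm
  have : Nonempty (Fin (Fintype.card V)) := e.nonempty
  refine spectralRadiusOrder_lt_top_iff.2 ⟨_, G.comap e,
    isGraphSpectralRadius_of_pos_eigenvector _ (x ∘ e) (fun v => hx _) fun v => ?_⟩
  simpa using (e.sum_comp fun w => if G.Adj (e v) w then x w else 0).trans (h (e v))

/-! ### Necessity: conjugates of a graph eigenvalue. -/

open Classical in
/-- The Rayleigh bound for the largest eigenvalue, applied to the absolute values of an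
eigenvector. -/
theorem IsGraphSpectralRadius.abs_le {V : Type*} [Fintype V] {G : SimpleGraph V} {lam μ : ℝ}
    (h : IsGraphSpectralRadius G lam) (hμ : μ ∈ spectrum ℝ (G.adjMatrix ℝ)) : |μ| ≤ lam := by
  set A := G.adjMatrix ℝ with hA
  have hherm : A.IsHermitian := G.isHermitian_adjMatrix ℝ
  have hpsd : (algebraMap ℝ (Matrix V V ℝ) lam - A).PosSemidef := by
    rw [Matrix.posSemidef_iff_isHermitian_and_spectrum_nonneg]
    refine ⟨?_, fun ν hν => ?_⟩
    · rw [Algebra.algebraMap_eq_smul_one]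
      exact (Matrix.isHermitian_one.smul (IsSelfAdjoint.all lam)).sub hherm
    · rw [← spectrum.singleton_sub_eq] at hν
      obtain ⟨_, rfl, κ, hκ, rfl⟩ := hν
      exact sub_nonneg.2 (h.2 hκ)
  rw [← Matrix.spectrum_toLin', ← Module.End.hasEigenvalue_iff_mem_spectrum] at hμ
  obtain ⟨y, hy, hy0⟩ := hμ.exists_hasEigenvector
  rw [Module.End.mem_eigenspace_iff, Matrix.toLin'_apply] at hy
  have hnorm : 0 < y ⬝ᵥ y := by
    have := Matrix.dotProduct_star_self_pos_iff.2 hy0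
    simpa using this
  have habs : (fun v => |y v|) ⬝ᵥ (fun v => |y v|) = y ⬝ᵥ y := by
    simp [dotProduct]
  have h1 := hpsd.re_dotProduct_nonneg (fun v => |y v|)
  rw [Matrix.sub_mulVec, dotProduct_sub, Algebra.algebraMap_eq_smul_one, Matrix.smul_mulVec,
    Matrix.one_mulVec, dotProduct_smul] at h1
  simp only [star_trivial, habs, RCLike.re_to_real, smul_eq_mul, sub_nonneg] at h1
  have h2 : |μ| * (y ⬝ᵥ y) ≤ (fun v => |y v|) ⬝ᵥ (A.mulVec fun v => |y v|) :=
    calc |μ| * (y ⬝ᵥ y) = |y ⬝ᵥ A.mulVec y| := by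
          rw [hy, dotProduct_smul, smul_eq_mul, abs_mul, abs_of_pos hnorm]
      _ ≤ _ := by
          simp only [dotProduct, Matrix.mulVec]
          refine (Finset.abs_sum_le_sum_abs _ _).trans (Finset.sum_le_sum fun v _ => ?_)
          rw [abs_mul]
          refine mul_le_mul_of_nonneg_left ?_ (abs_nonneg _)
          refine (Finset.abs_sum_le_sum_abs _ _).trans (Finset.sum_le_sum fun w _ => ?_)
          rw [abs_mul]
          refine mul_le_mul_of_nonneg_right (le_of_eq (abs_of_nonneg ?_)) (abs_nonneg _)
          rw [hA, SimpleGraph.adjMatrix_apply]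
          split_ifs <;> simp
  exact le_of_mul_le_mul_right (h2.trans h1) hnorm

open Classical in
/-- The algebraic conjugates of a graph eigenvalue are eigenvalues of the same graph. -/
theorem IsAlgConjugate.exists_mem_spectrum {V : Type*} [Fintype V] {G : SimpleGraph V}
    {lam : ℝ} (h : lam ∈ spectrum ℝ (G.adjMatrix ℝ)) {z : ℂ} (hz : IsAlgConjugate lam z) :
    ∃ μ ∈ spectrum ℝ (G.adjMatrix ℝ), z = (μ : ℂ) := by
  have map_charpoly (K : Type) [Field K] [Algebra ℚ K] :
      (G.adjMatrix K).charpoly = (G.adjMatrix ℚ).charpoly.map (algebraMap ℚ K) := by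
    rw [← Matrix.charpoly_map]
    congr 1
    ext i j
    simp [SimpleGraph.adjMatrix_apply, apply_ite]
  have hroot : Polynomial.aeval lam (G.adjMatrix ℚ).charpoly = 0 := by
    have := Matrix.mem_spectrum_iff_isRoot_charpoly.1 h
    rwa [map_charpoly, Polynomial.IsRoot, Polynomial.eval_map_algebraMap] at this
  have hzroot : Polynomial.aeval z (G.adjMatrix ℚ).charpoly = 0 :=
    Polynomial.aeval_eq_zero_of_dvd_aeval_eq_zero (minpoly.dvd ℚ lam hroot) hz
  have hC : z ∈ spectrum ℂ (G.adjMatrix ℂ) := by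
    rw [Matrix.mem_spectrum_iff_isRoot_charpoly, map_charpoly, Polynomial.IsRoot,
      Polynomial.eval_map_algebraMap, hzroot]
  rw [(G.isHermitian_adjMatrix ℂ).spectrum_eq_image_range] at hC
  obtain ⟨μ, -, rfl⟩ := hC
  refine ⟨μ, ?_, rfl⟩
  rw [Matrix.mem_spectrum_iff_isRoot_charpoly, map_charpoly, Polynomial.IsRoot,
    Polynomial.eval_map_algebraMap]
  have := Polynomial.aeval_algebraMap_apply ℂ μ (G.adjMatrix ℚ).charpoly
  exact (map_eq_zero (algebraMap ℝ ℂ)).1 (this.symm.trans hzroot)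

open Classical in
theorem IsGraphSpectralRadius.isTotallyRealInteger {V : Type*} [Fintype V] {G : SimpleGraph V}
    {lam : ℝ} (h : IsGraphSpectralRadius G lam) :
    IsTotallyRealInteger lam ∧ ∀ z : ℂ, IsAlgConjugate lam z → ‖z‖ ≤ lam := by
  refine ⟨⟨⟨(G.adjMatrix ℤ).charpoly, Matrix.charpoly_monic _, ?_⟩, fun z hz => ?_⟩,
    fun z hz => ?_⟩
  · have := Matrix.mem_spectrum_iff_isRoot_charpoly.1 h.1
    have hmap : (G.adjMatrix ℤ).map (algebraMap ℤ ℝ) = G.adjMatrix ℝ := by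
      ext i j
      simp [SimpleGraph.adjMatrix_apply, apply_ite]
    rwa [← Polynomial.eval_map, ← Matrix.charpoly_map, hmap]
  · obtain ⟨μ, -, rfl⟩ := hz.exists_mem_spectrum h.1
    simp
  · obtain ⟨μ, hμ, rfl⟩ := hz.exists_mem_spectrum h.1
    simpa using h.abs_le hμ

/-! ### Kronecker's theorem for `[-2, 2]`, via `lam = z + z⁻¹`. -/

open Polynomial IntermediateField in
theorem IsAlgConjugate.of_ringHom {lam : ℝ} {z : ℂ} (hz : z + z⁻¹ = (lam : ℂ))
    (φ : ℚ⟮z⟯ →+* ℂ) :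
    IsAlgConjugate lam (φ (AdjoinSimple.gen ℚ z) + (φ (AdjoinSimple.gen ℚ z))⁻¹) := by
  have h1 : aeval (AdjoinSimple.gen ℚ z + (AdjoinSimple.gen ℚ z)⁻¹) (minpoly ℚ lam) = 0 := by
    apply (algebraMap ℚ⟮z⟯ ℂ).injective
    rw [← aeval_algebraMap_apply, map_add, map_inv₀, AdjoinSimple.algebraMap_gen, hz, map_zero,
      ← Complex.coe_algebraMap, aeval_algebraMap_apply, minpoly.aeval, map_zero]
  have h2 := congrArg φ.toRatAlgHom h1
  rw [← aeval_algHom_apply, map_zero] at h2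
  simpa [IsAlgConjugate] using h2

-- `z` is a root of the monic `X ^ 2 - x X + 1` over the ring of algebraic integers; integrality is
-- transitive.
open Polynomial in
theorem isIntegral_of_add_inv {x z : ℂ} (hz0 : z ≠ 0) (hz : z + z⁻¹ = x) (hx : IsIntegral ℤ x) :
    IsIntegral ℤ z := by
  let A := integralClosure ℤ ℂ
  refine isIntegral_trans (A := A) z ⟨X ^ 2 - C (⟨x, hx⟩ : A) * X + C 1, by monicity!, ?_⟩
  simp only [eval₂_add, eval₂_sub, eval₂_mul, eval₂_pow, eval₂_X, eval₂_C, eval₂_one, map_one]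
  change z ^ 2 - x * z + 1 = 0
  rw [← hz]
  field_simp
  ring

/-- The roots of `X ^ 2 - μ X + 1` have product 1, and a discriminant `μ ^ 2 - 4 ≤ 0` makes them
complex conjugates. -/
theorem norm_eq_one_of_add_inv {w : ℂ} {μ : ℝ} (hw : w + w⁻¹ = (μ : ℂ)) (hμ : |μ| ≤ 2)
    (hw0 : w ≠ 0) : ‖w‖ = 1 := by
  have h1 : w ^ 2 - μ * w + 1 = 0 := by rw [← hw]; field_simp; ring
  have hre := congrArg Complex.re h1
  have him := congrArg Complex.im h1
  simp [pow_two] at hre him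
  have hμ2 : μ ^ 2 ≤ 4 := by nlinarith [sq_abs μ, abs_nonneg μ]
  have him' : w.im * (2 * w.re - μ) = 0 := by linarith
  have hsq : ‖w‖ ^ 2 = 1 := by
    rw [← Complex.normSq_eq_norm_sq, Complex.normSq_apply]
    rcases mul_eq_zero.1 him' with h | h
    · rw [h] at hre ⊢
      have h4 : (2 * w.re - μ) ^ 2 = μ ^ 2 - 4 := by linarith
      have h5 : 2 * w.re - μ = 0 := by nlinarith [sq_nonneg (2 * w.re - μ)]
      have : μ = 2 * w.re := by linarith
      rw [this] at hre
      linarith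
    · have : μ = 2 * w.re := by linarith
      rw [this] at hre
      linarith
  nlinarith [norm_nonneg w]

theorem exp_mul_I_add_inv (θ : ℝ) :
    Complex.exp (θ * Complex.I) + (Complex.exp (θ * Complex.I))⁻¹ = ((2 * Real.cos θ : ℝ) : ℂ) := by
  rw [← Complex.exp_neg]
  push_cast
  rw [Complex.two_cos, neg_mul]

open IntermediateField in
/-- Kronecker's theorem: an algebraic integer all of whose conjugates lie in `[-2, 2]` is twice the
cosine of a rational angle, and all Galois-conjugate angles give conjugates. -/
theorem exists_eq_two_mul_cos {lam : ℝ} (hlam : |lam| ≤ 2) (hint : IsIntegral ℤ lam)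
    (hconj : ∀ z : ℂ, IsAlgConjugate lam z → ∃ μ : ℝ, |μ| ≤ 2 ∧ z = μ) :
    ∃ m i : ℕ, 0 < m ∧ i < m ∧ i.Coprime m ∧ lam = 2 * Real.cos (2 * Real.pi * i / m) ∧
      ∀ k : ℕ, k.Coprime m →
        IsAlgConjugate lam ((2 * Real.cos (2 * Real.pi * k / m) : ℝ) : ℂ) := by
  obtain ⟨z, hz0, hz⟩ : ∃ z : ℂ, z ≠ 0 ∧ z + z⁻¹ = (lam : ℂ) := by
    refine ⟨Complex.exp (Real.arccos (lam / 2) * Complex.I), Complex.exp_ne_zero _, ?_⟩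
    rw [abs_le] at hlam
    rw [exp_mul_I_add_inv, Real.cos_arccos (by linarith) (by linarith)]
    congr 1
    ring
  have hzint : IsIntegral ℤ z :=
    isIntegral_of_add_inv hz0 hz (hint.map (Complex.ofRealHom.toIntAlgHom))
  have hzQ : IsIntegral ℚ z := hzint.tower_top
  have : FiniteDimensional ℚ ℚ⟮z⟯ := adjoin.finiteDimensional hzQ
  have : NumberField ℚ⟮z⟯ := { }
  have hgen0 : AdjoinSimple.gen ℚ z ≠ 0 := fun h => hz0 <| by
    rw [← AdjoinSimple.algebraMap_gen ℚ z, h, map_zero]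
  have hgenint : IsIntegral ℤ (AdjoinSimple.gen ℚ z) := by
    rw [← isIntegral_algebraMap_iff (B := ℂ) (algebraMap ℚ⟮z⟯ ℂ).injective,
      AdjoinSimple.algebraMap_gen]
    exact hzint
  obtain ⟨n, hn, hpow⟩ := NumberField.Embeddings.pow_eq_one_of_norm_eq_one ℚ⟮z⟯ ℂ hgenint
    fun φ => by
      obtain ⟨μ, hμ, h⟩ := hconj _ (IsAlgConjugate.of_ringHom hz φ)
      exact norm_eq_one_of_add_inv h hμ ((map_ne_zero φ).2 hgen0)
  have hzn : z ^ n = 1 := by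
    have := congrArg (algebraMap ℚ⟮z⟯ ℂ) hpow
    rwa [map_pow, AdjoinSimple.algebraMap_gen, map_one] at this
  have hprim := IsPrimitiveRoot.orderOf z
  have hm : 0 < orderOf z := orderOf_pos_iff.2 (isOfFinOrder_iff_pow_eq_one.2 ⟨n, hn, hzn⟩)
  set m := orderOf z
  have hexp (k : ℕ) : Complex.exp (2 * Real.pi * Complex.I * (k / m)) =
      Complex.exp ((2 * Real.pi * k / m : ℝ) * Complex.I) := by
    congr 1; push_cast; ring
  obtain ⟨i, him, hi, hiz⟩ := (Complex.isPrimitiveRoot_iff z m hm.ne').1 hprim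
  refine ⟨m, i, hm, him, hi, ?_, fun k hk => ?_⟩
  · rw [hexp] at hiz
    rw [← hiz, exp_mul_I_add_inv] at hz
    exact_mod_cast hz.symm
  · have hk' := Complex.isPrimitiveRoot_exp_of_coprime k m hm.ne' hk
    -- All primitive `m`-th roots of unity share the cyclotomic polynomial as minimal polynomial, so
    -- some embedding of `ℚ⟮z⟯` sends `z` to this one.
    have hmin : Polynomial.aeval (Complex.exp (2 * Real.pi * Complex.I * (k / m)))
        (minpoly ℚ z) = 0 := by
      rw [← Polynomial.cyclotomic_eq_minpoly_rat hprim hm,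
        Polynomial.cyclotomic_eq_minpoly_rat hk' hm, minpoly.aeval]
    let φ := (algHomAdjoinIntegralEquiv ℚ (K := ℂ) hzQ).symm
      ⟨_, (Polynomial.mem_aroots.2 ⟨minpoly.ne_zero hzQ, hmin⟩)⟩
    have hφ : φ (AdjoinSimple.gen ℚ z) = Complex.exp (2 * Real.pi * Complex.I * (k / m)) :=
      algHomAdjoinIntegralEquiv_symm_apply_gen ℚ hzQ _
    have := IsAlgConjugate.of_ringHom hz φ.toRingHom
    simp only [AlgHom.toRingHom_eq_coe, RingHom.coe_coe] at this
    rwa [hφ, hexp, exp_mul_I_add_inv] at this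

/-! ### Dominant cosines. -/

theorem cos_two_pi_mul_div_le {m i : ℕ} (hi : 0 < i) (him : i < m) :
    Real.cos (2 * Real.pi * i / m) ≤ Real.cos (2 * Real.pi * 1 / m) := by
  have hm : (0 : ℝ) < m := by exact_mod_cast hi.trans him
  have low (j : ℕ) (hj : 0 < j) (hjm : 2 * j ≤ m) :
      Real.cos (2 * Real.pi * j / m) ≤ Real.cos (2 * Real.pi * 1 / m) := by
    have hj' : (1 : ℝ) ≤ j := by exact_mod_cast hj
    have hjm' : (2 * j : ℝ) ≤ m := by exact_mod_cast hjm
    refine Real.cos_le_cos_of_nonneg_of_le_pi (by positivity) ?_ ?_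
    · rw [div_le_iff₀ hm]
      nlinarith [Real.pi_pos]
    · gcongr
  rcases le_or_gt (2 * i) m with h | h
  · exact low i hi h
  · have hsub := low (m - i) (by omega) (by omega)
    rw [Nat.cast_sub him.le] at hsub
    rwa [show 2 * Real.pi * ((m : ℝ) - i) / m = 2 * Real.pi - 2 * Real.pi * i / m by
      field_simp, Real.cos_two_pi_sub] at hsub

/-- Since `k = 1` gives a conjugate, dominance forces the angle `2π / m` unless `lam = 2`. Even `m =
2n` gives `π / n`; odd `m` is impossible because a conjugate near `-2` is larger in absolute value.
-/
theorem eq_two_or_eq_two_mul_cos_pi_div {lam : ℝ} (hpos : 0 < lam) (hle : lam ≤ 2)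
    (hreal : IsTotallyRealInteger lam) (hbound : ∀ z : ℂ, IsAlgConjugate lam z → ‖z‖ ≤ lam) :
    lam = 2 ∨ ∃ n : ℕ, 3 ≤ n ∧ lam = 2 * Real.cos (Real.pi / n) := by
  obtain ⟨m, i, hm, him, hi, heq, hconj⟩ := exists_eq_two_mul_cos
    (by rwa [abs_of_pos hpos]) hreal.1 fun z hz => by
      have hzre : z = (z.re : ℂ) := Complex.ext rfl (by simpa using hreal.2 z hz)
      refine ⟨z.re, ?_, hzre⟩
      rw [← Real.norm_eq_abs, ← Complex.norm_real, ← hzre]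
      exact (hbound z hz).trans hle
  have hcos (k : ℕ) (hk : k.Coprime m) : |2 * Real.cos (2 * Real.pi * k / m)| ≤ lam := by
    rw [← Real.norm_eq_abs, ← Complex.norm_real]
    exact hbound _ (hconj k hk)
  have hmR : (0 : ℝ) < m := by exact_mod_cast hm
  rcases Nat.eq_zero_or_pos i with rfl | hi0
  · left
    simpa using heq
  right
  have hmax : lam = 2 * Real.cos (2 * Real.pi * 1 / m) := by
    refine le_antisymm ?_ ?_
    · rw [heq]
      linarith [cos_two_pi_mul_div_le hi0 him]
    · simpa using (le_abs_self _).trans (hcos 1 m.coprime_one_left)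
  rcases Nat.even_or_odd' m with ⟨n, rfl | rfl⟩
  · have hn : lam = 2 * Real.cos (Real.pi / n) := by
      rw [hmax]
      congr 2
      push_cast
      field_simp
    refine ⟨n, ?_, hn⟩
    by_contra hlt
    obtain rfl | rfl : n = 1 ∨ n = 2 := by omega
    · norm_num at hn
      linarith
    · norm_num at hn
      linarith
  · exfalso
    -- `n` is coprime to `2n + 1`, and its angle is `π - π / m`.
    have hk := hcos n (by simp)
    have hpi := Real.pi_pos
    have hn : (1 : ℝ) ≤ n := by exact_mod_cast (by omega : 1 ≤ n)
    rw [show 2 * Real.pi * n / ((2 * n + 1 : ℕ) : ℝ) = Real.pi - Real.pi / ((2 * n + 1 : ℕ) : ℝ) by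
      field_simp; push_cast; ring, Real.cos_pi_sub] at hk
    have hlt : Real.cos (2 * Real.pi * 1 / ((2 * n + 1 : ℕ) : ℝ)) <
        Real.cos (Real.pi / ((2 * n + 1 : ℕ) : ℝ)) := by
      refine Real.cos_lt_cos_of_nonneg_of_le_pi (by positivity) ?_ ?_
      · rw [div_le_iff₀ hmR]
        push_cast
        nlinarith
      · gcongr
        linarith
    have := neg_abs_le (2 * -Real.cos (Real.pi / ((2 * n + 1 : ℕ) : ℝ)))
    linarith

/-! ### Graphs realising quadratic integers, paths and complete graphs. -/

/-- The disjoint union of `(s + 1)` copies of `K_{p+1}` and `(p + 1) * c` copies of `K_{s+1}`, with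
every vertex of the first part joined to `c` vertices of the second part, and every vertex of the
second part joined to one vertex of the first. -/
def biregularGraph (p s c : ℕ) :
    SimpleGraph ((Fin (p + 1) × Fin (s + 1)) ⊕ (Fin (p + 1) × Fin c × Fin (s + 1))) where
  Adj u v := match u, v with
    | .inl (i, j), .inl (i', j') => i ≠ i' ∧ j = j'
    | .inl (i, j), .inr (i', _, j') => i = i' ∧ j = j'
    | .inr (i, _, j), .inl (i', j') => i = i' ∧ j = j'
    | .inr (i, k, j), .inr (i', k', j') => (i = i' ∧ k = k') ∧ j ≠ j'
  symm := ⟨by rintro (⟨i, j⟩ | ⟨i, k, j⟩) (⟨i', j'⟩ | ⟨i', k', j'⟩) h <;> grind⟩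
  loopless := ⟨by rintro (⟨i, j⟩ | ⟨i, k, j⟩) h <;> grind⟩

section

variable {p s c : ℕ} {i i' : Fin (p + 1)} {j j' : Fin (s + 1)} {k k' : Fin c}

theorem biregularGraph_adj_inl_inl :
    (biregularGraph p s c).Adj (.inl (i, j)) (.inl (i', j')) ↔ i ≠ i' ∧ j = j' := Iff.rfl

theorem biregularGraph_adj_inl_inr :
    (biregularGraph p s c).Adj (.inl (i, j)) (.inr (i', k', j')) ↔ i = i' ∧ j = j' := Iff.rfl

theorem biregularGraph_adj_inr_inl :
    (biregularGraph p s c).Adj (.inr (i, k, j)) (.inl (i', j')) ↔ i = i' ∧ j = j' := Iff.rfl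

theorem biregularGraph_adj_inr_inr :
    (biregularGraph p s c).Adj (.inr (i, k, j)) (.inr (i', k', j')) ↔
      (i = i' ∧ k = k') ∧ j ≠ j' := Iff.rfl

end

/-- The two vertex classes have quotient matrix `[[p, c], [1, s]]`, with characteristic polynomial
`(X - p)(X - s) - c` and eigenvector `(lam - s, 1)`, positive because `s < lam`. -/
theorem spectralRadiusOrder_lt_top_of_mul_eq {lam : ℝ} (p s c : ℕ) (hs : (s : ℝ) < lam)
    (h : (lam - p) * (lam - s) = c) : spectralRadiusOrder lam < ⊤ := by
  classical
  have sum_ne (n : ℕ) (i : Fin (n + 1)) (t : ℝ) :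
      ∑ j : Fin (n + 1), (if i ≠ j then t else 0) = n * t := by
    rw [← Finset.sum_filter, Finset.sum_const, Finset.filter_ne, Finset.card_erase_of_mem
      (Finset.mem_univ i)]
    simp
  refine spectralRadiusOrder_lt_top_of_pos_eigenvector (biregularGraph p s c)
    (Sum.elim (fun _ => lam - s) fun _ => 1) ?_ ?_
  · rintro (v | v)
    · simpa using hs
    · simp
  · rintro (⟨i, j⟩ | ⟨i, k, j⟩)
    · simp only [Fintype.sum_sum_type, Fintype.sum_prod_type, Sum.elim_inl, Sum.elim_inr,
        biregularGraph_adj_inl_inl, biregularGraph_adj_inl_inr, ite_and]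
      simp only [Finset.sum_ite_eq, Finset.mem_univ, if_true, Finset.sum_const_zero,
        Finset.sum_ite_irrel, Finset.sum_const, sum_ne]
      simp
      linarith
    · simp only [Fintype.sum_sum_type, Fintype.sum_prod_type, Sum.elim_inl, Sum.elim_inr,
        biregularGraph_adj_inr_inl, biregularGraph_adj_inr_inr, ite_and]
      simp only [Finset.sum_ite_eq, Finset.mem_univ, if_true, Finset.sum_const_zero,
        Finset.sum_ite_irrel, sum_ne]
      ring

theorem isGraphSpectralRadius_pathGraph {n : ℕ} (hn : 2 ≤ n) :
    IsGraphSpectralRadius (SimpleGraph.pathGraph (n - 1)) (2 * Real.cos (Real.pi / n)) := by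
  classical
  obtain ⟨m, rfl⟩ : ∃ m, n = m + 2 := ⟨n - 2, by omega⟩
  change IsGraphSpectralRadius (SimpleGraph.pathGraph (m + 1)) _
  set θ := Real.pi / ((m + 2 : ℕ) : ℝ) with hθ
  have hθm : θ * (m + 2) = Real.pi := by rw [hθ]; push_cast; field_simp
  have hθ0 : 0 < θ := by positivity
  refine isGraphSpectralRadius_of_pos_eigenvector _
    (fun v => Real.sin (((v : ℕ) + 1) * θ)) (fun v => ?_) fun v => ?_
  · have hv : ((v : ℕ) : ℝ) + 1 < m + 2 := by exact_mod_cast (by omega : (v : ℕ) + 1 < m + 2)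
    refine Real.sin_pos_of_pos_of_lt_pi (by positivity) ?_
    nlinarith
  · have split (w : Fin (m + 1)) :
        (if (SimpleGraph.pathGraph (m + 1)).Adj v w then Real.sin (((w : ℕ) + 1) * θ) else 0) =
          (if (v : ℕ) + 1 = w then Real.sin (((v : ℕ) + 2) * θ) else 0) +
          (if (w : ℕ) + 1 = v then Real.sin ((v : ℕ) * θ) else 0) := by
      rw [SimpleGraph.pathGraph_adj]
      by_cases h1 : (v : ℕ) + 1 = w
      · rw [if_pos (Or.inl h1), if_pos h1, if_neg (by omega), add_zero, ← h1]
        push_cast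
        ring_nf
      · by_cases h2 : (w : ℕ) + 1 = v
        · rw [if_pos (Or.inr h2), if_neg h1, if_pos h2, zero_add, ← h2]
          push_cast
          rfl
        · rw [if_neg (by tauto), if_neg h1, if_neg h2, add_zero]
    have right : ∑ w : Fin (m + 1),
        (if (v : ℕ) + 1 = w then Real.sin (((v : ℕ) + 2) * θ) else 0) =
          Real.sin (((v : ℕ) + 2) * θ) := by
      by_cases hv : (v : ℕ) + 1 < m + 1
      · rw [Finset.sum_eq_single ⟨v + 1, hv⟩ _ (by simp)]
        · simp
        · intro w _ hw
          exact if_neg fun h => hw (Fin.ext h.symm)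
      · have hvm : ((v : ℕ) : ℝ) = m := by exact_mod_cast (by omega : (v : ℕ) = m)
        rw [hvm, mul_comm, hθm, Real.sin_pi]
        simp
    have left : ∑ w : Fin (m + 1),
        (if (w : ℕ) + 1 = v then Real.sin ((v : ℕ) * θ) else 0) = Real.sin ((v : ℕ) * θ) := by
      by_cases hv : (v : ℕ) = 0
      · simp [hv]
      · rw [Finset.sum_eq_single ⟨v - 1, by omega⟩ _ (by simp)]
        · exact if_pos (by simp; omega)
        · intro w _ hw
          exact if_neg fun h => hw (Fin.ext (by simp; omega))
    rw [Finset.sum_congr rfl fun w _ => split w, Finset.sum_add_distrib, right, left,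
      show ((v : ℕ) + 2 : ℝ) * θ = ((v : ℕ) + 1) * θ + θ by ring,
      show ((v : ℕ) : ℝ) * θ = ((v : ℕ) + 1) * θ - θ by ring, Real.sin_add, Real.sin_sub]
    ring

theorem isGraphSpectralRadius_completeGraph (n : ℕ) :
    IsGraphSpectralRadius (SimpleGraph.completeGraph (Fin (n + 1))) n := by
  classical
  refine isGraphSpectralRadius_of_pos_eigenvector _ (fun _ => 1) (fun _ => one_pos) fun v => ?_
  have hadj (w : Fin (n + 1)) : (SimpleGraph.completeGraph (Fin (n + 1))).Adj v w ↔ v ≠ w := Iff.rfl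
  simp only [hadj]
  rw [← Finset.sum_filter, Finset.sum_const]
  simp [Finset.filter_ne, Finset.card_erase_of_mem]

/-! ### The quadratic case and the conclusion. -/

open Polynomial in
theorem spectralRadiusOrder_lt_top_of_natDegree_eq_two {lam : ℝ} (hpos : 0 < lam)
    (hdeg : (minpoly ℚ lam).natDegree = 2) (hint : IsIntegral ℤ lam)
    (hbound : ∀ z : ℂ, IsAlgConjugate lam z → ‖z‖ ≤ lam) : spectralRadiusOrder lam < ⊤ := by
  have hmap := minpoly.isIntegrallyClosed_eq_field_fractions' ℚ hint
  set P := minpoly ℤ lam with hP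
  have hmonic : P.Monic := minpoly.monic hint
  have hdegZ : P.natDegree = 2 := by
    rw [← hdeg, hmap, hmonic.natDegree_map]
  have haeval {R : Type} [CommRing R] (x : R) :
      aeval x P = x ^ 2 + P.coeff 1 * x + P.coeff 0 := by
    have hlead : P.coeff 2 = 1 := by rw [← hdegZ]; exact hmonic
    rw [aeval_eq_sum_range, hdegZ]
    simp [Finset.sum_range_succ, hlead]
    ring
  have hroot : lam ^ 2 + P.coeff 1 * lam + P.coeff 0 = 0 := by
    rw [← haeval, hP, minpoly.aeval]
  have hirr (n : ℤ) : lam ≠ n := by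
    rintro rfl
    have := minpoly.eq_X_sub_C ℝ (n : ℚ)
    simp only [eq_ratCast, Rat.cast_intCast] at this
    rw [this, natDegree_X_sub_C] at hdeg
    omega
  have hconj : IsAlgConjugate lam ((-P.coeff 1 - lam : ℝ) : ℂ) := by
    rw [IsAlgConjugate, hmap, aeval_map_algebraMap, haeval]
    have : (-P.coeff 1 - lam : ℝ) ^ 2 + P.coeff 1 * (-P.coeff 1 - lam : ℝ) + P.coeff 0 = 0 := by
      rw [← hroot]; ring
    exact_mod_cast congrArg (Complex.ofReal) this
  have hb := hbound _ hconj
  rw [Complex.norm_real, Real.norm_eq_abs, abs_le] at hb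
  -- `a` is the trace `lam + lam'`, nonnegative because `|lam'| ≤ lam`; the same bound gives `a ≤ 2
  -- lam`.
  obtain ⟨a, ha⟩ : ∃ a : ℕ, P.coeff 1 = -a := by
    have h0 : P.coeff 1 ≤ 0 := by
      have : (P.coeff 1 : ℝ) ≤ 0 := by linarith
      exact_mod_cast this
    exact ⟨(-P.coeff 1).toNat, by omega⟩
  rw [ha] at hb hroot
  push_cast at hb hroot
  obtain ⟨p, s, hps, hsp, hsp'⟩ : ∃ p s : ℕ, p + s = a ∧ p ≤ s ∧ s ≤ p + 1 :=
    ⟨a / 2, a - a / 2, by omega, by omega, by omega⟩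
  have hpsR : (p : ℝ) + s = a := by exact_mod_cast hps
  have hspR : (p : ℝ) ≤ s := by exact_mod_cast hsp
  have hspR' : (s : ℝ) ≤ p + 1 := by exact_mod_cast hsp'
  have hprod : (lam - p) * (lam - s) = ((p * s - P.coeff 0 : ℤ) : ℝ) := by
    push_cast
    rw [← hpsR] at hroot
    linarith
  have hp : 0 < lam - p := by
    have hne := hirr p
    push_cast at hne
    exact lt_of_le_of_ne (by linarith) fun h => hne (by linarith)
  have hs0 : lam - s ≠ 0 := fun h => hirr s (by push_cast; linarith)
  have hc : 0 < (p * s - P.coeff 0 : ℤ) := by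
    refine lt_of_le_of_ne ?_ fun h => mul_ne_zero hp.ne' hs0 (by rw [hprod, ← h, Int.cast_zero])
    -- With `t = lam - p > 0` and `s ≤ p + 1`, the product is at least `t (t - 1) ≥ -1/4`. Being a
    -- nonzero integer, it is positive, which also yields `s < lam`.
    have : (-1 : ℝ) < ((p * s - P.coeff 0 : ℤ) : ℝ) := by
      rw [← hprod]
      nlinarith [sq_nonneg (lam - p - 1 / 2)]
    have : (-1 : ℤ) < p * s - P.coeff 0 := by exact_mod_cast this
    omega
  obtain ⟨c, hc'⟩ := Int.eq_ofNat_of_zero_le hc.le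
  refine spectralRadiusOrder_lt_top_of_mul_eq p s c ?_ (by rw [hprod, hc']; simp)
  have : 0 < (lam - p) * (lam - s) := by rw [hprod]; exact_mod_cast hc
  exact sub_pos.1 (pos_of_mul_pos_right this hp.le)

theorem theorem1p2 (lam : ℝ) (hpos : 0 < lam)
    (h : (minpoly ℚ lam).natDegree = 2 ∨ lam ≤ 2) :
    (spectralRadiusOrder lam < ⊤ ↔
      IsTotallyRealInteger lam ∧ ∀ z : ℂ, IsAlgConjugate lam z → ‖z‖ ≤ lam) ∧
    (lam ≤ 2 → spectralRadiusOrder lam < ⊤ →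
      (∃ n : ℕ, 3 ≤ n ∧ lam = 2 * Real.cos (Real.pi / n) ∧
        IsGraphSpectralRadius (SimpleGraph.pathGraph (n - 1)) lam) ∨
      (lam = 2 ∧ IsGraphSpectralRadius (SimpleGraph.completeGraph (Fin 3)) lam)) := by
  have forward (hfin : spectralRadiusOrder lam < ⊤) :
      IsTotallyRealInteger lam ∧ ∀ z : ℂ, IsAlgConjugate lam z → ‖z‖ ≤ lam := by
    obtain ⟨m, G, hG⟩ := spectralRadiusOrder_lt_top_iff.1 hfin
    exact hG.isTotallyRealInteger
  -- Assuming only the conjugate conditions lets this serve both the converse for `lam ≤ 2` and the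
  -- final classification.
  have small (hle : lam ≤ 2)
      (hconj : IsTotallyRealInteger lam ∧ ∀ z : ℂ, IsAlgConjugate lam z → ‖z‖ ≤ lam) :
      (∃ n : ℕ, 3 ≤ n ∧ lam = 2 * Real.cos (Real.pi / n) ∧
        IsGraphSpectralRadius (SimpleGraph.pathGraph (n - 1)) lam) ∨
      (lam = 2 ∧ IsGraphSpectralRadius (SimpleGraph.completeGraph (Fin 3)) lam) := by
    rcases eq_two_or_eq_two_mul_cos_pi_div hpos hle hconj.1 hconj.2 with rfl | ⟨n, hn, rfl⟩
    · exact Or.inr ⟨rfl, by simpa using isGraphSpectralRadius_completeGraph 2⟩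
    · exact Or.inl ⟨n, hn, rfl, isGraphSpectralRadius_pathGraph (by omega)⟩
  refine ⟨⟨forward, fun hconj => ?_⟩, fun hle hfin => small hle (forward hfin)⟩
  rcases h with hdeg | hle
  · exact spectralRadiusOrder_lt_top_of_natDegree_eq_two hpos hdeg hconj.1.1 hconj.2
  · rcases small hle hconj with ⟨n, -, -, hG⟩ | ⟨-, hG⟩ <;>
      exact spectralRadiusOrder_lt_top_iff.2 ⟨_, _, hG⟩
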